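/- Graphs are finite multigraphs, possibly with loops. Let $k,\ell$ be integers with $0\le \ell\le k$. A finite graph $G$ with $n$ vertices is *$(k,\ell)$-sparse* if every non-empty subgraph of $G$, with $n'$ vertices and $m'$ edges, satisfies $m'\le kn'-\ell$; it is *$(k,\ell)$-tight* if it is $(k,\ell)$-sparse and has exactly $kn-\ell$ edges. The *$(k,\ell)$-pebble game with colors* is played on a fixed finite vertex set $V$. A configuration is a directed multigraph $H$ on $V$ with colored pebbles on its vertices and exactly one colored pebble on each edge, the colors being $c_1,\dots,c_k$. Initially $H$ has no edges and each vertex carries $k$ pebbles, one of each color. A move is one of the following. * *Add-edge:* let $v,w\in V$ (possibly $v=w$) be such that the set $\{v,w\}$ carries at least $\ell+1$ pebbles in total and $v$ carries at least one pebble. Pick up a pebble from $v$, add a new edge directed from $v$ to $w$, and put this pebble on the new edge. * *Pebble-slide:* let $w$ be a vertex with a pebble $p$ on it and let $vw$ be an edge directed from $v$ to $w$. Replace it by the reversed edge $wv$, put the pebble that was on $vw$ on the vertex $v$, and put $p$ on $wv$. A graph $G$ is a *$(k,\ell)$-pebble-game graph* if it is the underlying undirected graph of a configuration that is reached from the initial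 configuration on $V(G)$ by finitely many moves. A *map-graph* is a graph that admits an orientation in which every vertex has out-degree exactly one. A graph $G$ is a *$(k,\ell)$-maps-and-trees* if its edge set is the disjoint union of the edge sets of $\ell$ spanning trees of $G$ and $k-\ell$ map-graphs that are spanning subgraphs of $G$ (each of them has vertex set $V(G)$). **Theorem.** Let $0\le \ell\le k$. A finite graph $G$ is both $(k,\ell)$-tight and a $(k,\ell)$-pebble-game graph if and only if $G$ is a $(k,\ell)$-maps-and-trees. -/

import Mathlib

open scoped Graph

namespace Graph

variable {α β : Type*}

/-! ### Sparse and tight multigraphs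

`Graph α β` is Mathlib's type of multigraphs, in which loops and parallel edges are allowed. -/

/-- `G` is `(k, ℓ)`-sparse: every non-empty subgraph with `n'` vertices and `m'` edges satisfies
`m' ≤ k n' - ℓ` (computed in the integers). Here a subgraph is non-empty if it has an edge; if
`ℓ ≤ k` then a subgraph that has a vertex but no edge satisfies the inequality automatically. -/
def IsSparse (G : Graph α β) (k ℓ : ℕ) : Prop :=
  ∀ H : Graph α β, H ≤ G → E(H).Nonempty →
    (E(H).ncard : ℤ) ≤ (k : ℤ) * (V(H).ncard : ℤ) - (ℓ : ℤ)

/-- `G` is `(k, ℓ)`-tight: it is `(k, ℓ)`-sparse and has exactly `k n - ℓ` edges. -/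
def IsTight (G : Graph α β) (k ℓ : ℕ) : Prop :=
  G.IsSparse k ℓ ∧ (E(G).ncard : ℤ) = (k : ℤ) * (V(G).ncard : ℤ) - (ℓ : ℤ)

/-! ### Map-graphs -/

/-- An orientation of a multigraph: every edge gets a tail and a head, which are its two ends. -/
structure Orientation (G : Graph α β) where
  tail : E(G) → α
  head : E(G) → α
  isLink : ∀ e : E(G), G.IsLink e (tail e) (head e)

/-- The out-degree of `v`: the number of edges with tail `v`. -/
noncomputable def Orientation.outDegree {G : Graph α β} (o : G.Orientation) (v : α) : ℕ :=
  {e : E(G) | o.tail e = v}.ncard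

/-- A map-graph is a graph with an orientation in which every vertex has out-degree exactly one. -/
def IsMapGraph (G : Graph α β) : Prop :=
  ∃ o : G.Orientation, ∀ v ∈ V(G), o.outDegree v = 1

/-! ### Trees -/

/-- `G` is connected: it has a vertex, and any two vertices are joined by a walk. -/
def IsConnected (G : Graph α β) : Prop :=
  V(G).Nonempty ∧ ∀ x ∈ V(G), ∀ y ∈ V(G), Relation.ReflTransGen G.Adj x y

/-- `v 0, e 0, v 1, e 1, …, v n, e n, v 0` is a cycle of length `n + 1`: its vertices are distinct,
its edges are distinct, and `e i` joins `v i` to `v (i + 1)`, where the addition in `Fin (n + 1)`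
is cyclic. A loop is a cycle of length one, a pair of parallel edges a cycle of length two. -/
def IsCycle (G : Graph α β) {n : ℕ} (v : Fin (n + 1) → α) (e : Fin (n + 1) → β) : Prop :=
  Function.Injective v ∧ Function.Injective e ∧ ∀ i, G.IsLink (e i) (v i) (v (i + 1))

/-- A tree is a connected graph without cycles. -/
def IsTree (G : Graph α β) : Prop :=
  G.IsConnected ∧
    ∀ (n : ℕ) (v : Fin (n + 1) → α) (e : Fin (n + 1) → β), ¬ G.IsCycle v e

/-! ### Maps-and-trees -/

/-- `G` is a `(k, ℓ)`-maps-and-trees (for `ℓ ≤ k`): it is the edge-disjoint union of `ℓ` spanning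
trees `T j` and `k - ℓ` spanning map-graphs `M i`. (`H ≤s G` says that `H` is a subgraph of `G`
with the same vertex set.) -/
def IsMapsAndTrees (G : Graph α β) (k ℓ : ℕ) : Prop :=
  ∃ (T : Fin ℓ → Graph α β) (M : Fin (k - ℓ) → Graph α β),
    (∀ j, T j ≤s G ∧ (T j).IsTree) ∧
    (∀ i, M i ≤s G ∧ (M i).IsMapGraph) ∧
    Pairwise (fun a b => Disjoint E(Sum.elim T M a) E(Sum.elim T M b)) ∧
    E(G) = ⋃ a, E(Sum.elim T M a)

end Graph

/-! ### The pebble game with colors -/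

/-- A configuration of the pebble game: a directed multigraph with colored pebbles on its vertices
and one colored pebble on each of its edges. The colors are the elements of `Fin k`.

* `arc e = none` says that `e` is not an edge of the current graph, and `arc e = some (v, w, c)`
  says that `e` is currently an edge directed from `v` to `w` with a pebble of color `c` on it;
* `peb v c` is the number of pebbles of color `c` on the vertex `v`. -/
structure PebbleConfig (α β : Type*) (k : ℕ) where
  arc : β → Option (α × α × Fin k)
  peb : α → Fin k → ℕ

namespace PebbleConfig

variable {α β : Type*} {k : ℕ}

open Classical in
/-- The initial configuration on the vertex set `V`: no edges, and on each vertex `k` pebbles, one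
of each color. -/
noncomputable def initial (V : Set α) : PebbleConfig α β k where
  arc := fun _ => none
  peb := fun v _ => if v ∈ V then 1 else 0

/-- The number of pebbles, of all colors, on a finite set of vertices. -/
def pebCount (H : PebbleConfig α β k) (S : Finset α) : ℕ :=
  ∑ u ∈ S, ∑ c, H.peb u c

open Classical in
/-- Put the edge `e`, directed from `v` to `w` and covered by a pebble of color `c`, into the graph
(replacing the arc of `e` if there is one). -/
noncomputable def setArc (H : PebbleConfig α β k) (e : β) (v w : α) (c : Fin k) :
    PebbleConfig α β k where
  arc := Function.update H.arc e (some (v, w, c))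
  peb := H.peb

open Classical in
/-- Pick up a pebble of color `c` from the vertex `v`. -/
noncomputable def pickUp (H : PebbleConfig α β k) (v : α) (c : Fin k) : PebbleConfig α β k where
  arc := H.arc
  peb := Function.update H.peb v (Function.update (H.peb v) c (H.peb v c - 1))

open Classical in
/-- Put a pebble of color `c` down on the vertex `v`. -/
noncomputable def putDown (H : PebbleConfig α β k) (v : α) (c : Fin k) : PebbleConfig α β k where
  arc := H.arc
  peb := Function.update H.peb v (Function.update (H.peb v) c (H.peb v c + 1))

open Classical in
/-- The moves of the `(k, ℓ)`-pebble game with colors on the vertex set `V`. -/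
inductive Move (V : Set α) (ℓ : ℕ) : PebbleConfig α β k → PebbleConfig α β k → Prop
  /-- Add-edge: `v` and `w` are vertices (possibly equal) with at least `ℓ + 1` pebbles on the set
  `{v, w}`, and there is a pebble of color `c` on `v`. Pick it up, add a new edge `e` directed from
  `v` to `w`, and put the pebble on `e`. -/
  | addEdge (H : PebbleConfig α β k) (e : β) (v w : α) (c : Fin k)
      (hv : v ∈ V) (hw : w ∈ V) (he : H.arc e = none)
      (hpeb : ℓ + 1 ≤ H.pebCount {v, w}) (hc : 1 ≤ H.peb v c) :
      Move V ℓ H ((H.pickUp v c).setArc e v w c)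
  /-- Pebble-slide: there is a pebble of color `c` on `w`, and `e` is an edge directed from `v` to
  `w` with a pebble of color `d` on it. Reverse `e`, put the pebble that was on `e` on `v`, and put
  the pebble from `w` on `e`. -/
  | pebbleSlide (H : PebbleConfig α β k) (e : β) (v w : α) (c d : Fin k)
      (hc : 1 ≤ H.peb w c) (he : H.arc e = some (v, w, d)) :
      Move V ℓ H (((H.pickUp w c).putDown v d).setArc e w v c)

/-- `H` is the output of some play of the `(k, ℓ)`-pebble game on the vertex set `V`: it arises from
the initial configuration by finitely many moves. -/
def IsOutput (V : Set α) (ℓ : ℕ) (H : PebbleConfig α β k) : Prop :=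
  Relation.ReflTransGen (Move V ℓ) (initial V) H

end PebbleConfig

/-- `G` is a `(k, ℓ)`-pebble-game graph: it is the underlying undirected graph of the output of
some play of the `(k, ℓ)`-pebble game with colors on the vertex set of `G`. -/
def Graph.IsPebbleGameGraph {α β : Type*} (G : Graph α β) (k ℓ : ℕ) : Prop :=
  ∃ H : PebbleConfig α β k, H.IsOutput V(G) ℓ ∧
    ∀ e x y, G.IsLink e x y ↔ ∃ c, H.arc e = some (x, y, c) ∨ H.arc e = some (y, x, c)

/-! The pebble game only has to be treated in one direction: every sparse graph can be built by it,
so the theorem reduces to "tight iff maps-and-trees" together with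
`Graph.IsSparse.isPebbleGameGraph`.

Maps-and-trees are tight by counting (`IsMapsAndTrees.isTight`). On a nonempty set of `n'` vertices
a tree has at most `n' - 1` edges and a map-graph at most `n'`, with equality on the whole vertex
set; now add up over `ℓ` trees and `k - ℓ` map-graphs.

Conversely (`IsTight.isMapsAndTrees`), the edges are partitioned as in matroid union, with `ℓ`
copies of the cycle-matroid rank and `k - ℓ` copies of the number of covered vertices
(`exists_partition_of_submodular`). The union condition follows from sparsity, one connected
component at a time (`IsSparse.card_le_rank_add`). The parts have at most `n - 1` and at most `n`
edges respectively, and the total `k n - ℓ` forces equality everywhere. An independent set of `n -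
1` edges is a spanning tree, and Hall's theorem orients a part with `n` edges as a map-graph.
Graphic rank is linear rank of incidence vectors over the field with two elements.

For the game, edges are inserted one by one, keeping pebbles plus out-degree equal to `k` at every
vertex; colors never matter. If the ends of the next edge carry at most `ℓ` pebbles and no other
pebble is reachable from them, then the reachable set already spans at least `k n' - ℓ` edges, and
the new edge violates sparsity. Otherwise a reachable pebble is slid back to an end
(`exists_pebCount_succ`). -/

/-- A chain of related elements can be shortened to one without repetitions. -/
theorem Relation.ReflTransGen.exists_injOn_path {α : Type*} {r : α → α → Prop} {x y : α}
    (h : Relation.ReflTransGen r x y) :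
    ∃ (n : ℕ) (w : ℕ → α), w 0 = x ∧ w n = y ∧ (∀ i < n, r (w i) (w (i + 1))) ∧
      Set.InjOn w (Set.Iic n) := by
  induction h using Relation.ReflTransGen.head_induction_on with
  | refl =>
    refine ⟨0, fun _ => y, rfl, rfl, by simp, ?_⟩
    intro i hi j hj _
    simp only [Set.mem_Iic] at hi hj
    omega
  | @head a b hab _ ih =>
    obtain ⟨n, w, h0, hn, hr, hinj⟩ := ih
    by_cases hmem : ∃ i ≤ n, w i = a
    · obtain ⟨i, hi, rfl⟩ := hmem
      refine ⟨n - i, fun m => w (m + i), by simp, by simp [hi, hn], ?_, ?_⟩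
      · intro m hm
        have := hr (m + i) (by omega)
        rwa [show m + i + 1 = m + 1 + i by omega] at this
      · intro p hp q hq hpq
        simp only [Set.mem_Iic] at hp hq
        have := hinj (show p + i ≤ n by omega) (show q + i ≤ n by omega) hpq
        omega
    · push Not at hmem
      refine ⟨n + 1, fun m => Nat.casesOn m a w, rfl, hn, ?_, ?_⟩
      · rintro (_ | m) hm
        · simpa [h0] using hab
        · exact hr m (by omega)
      · rintro (_ | p) hp (_ | q) hq hpq
        · rfl
        · exact absurd hpq.symm (hmem q (by simpa using hq))
        · exact absurd hpq (hmem p (by simpa using hp))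
        · have := hinj (show p ≤ n by simpa using hp) (show q ≤ n by simpa using hq) hpq
          omega

/-! ### Partition into independent sets for submodular functions. -/

open Classical in
/-- If a list assignment `C` satisfies the union condition for submodular functions and the list of
`e` has two distinct colors, then one of them can be removed. -/
theorem exists_erase_color {ι β : Type*} [Fintype ι] (f : ι → Finset β → ℕ)
    (hmono : ∀ j, Monotone (f j))
    (hsub : ∀ j A B, f j (A ∪ B) + f j (A ∩ B) ≤ f j A + f j B) (E : Finset β)
    (C : β → Finset ι) (hC : ∀ A ⊆ E, A.card ≤ ∑ j, f j {a ∈ A | j ∈ C a})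
    (e : β) {i j : ι} (hij : i ≠ j) :
    (∀ A ⊆ E, A.card ≤ ∑ t, f t {a ∈ A | t ∈ Function.update C e ((C e).erase i) a}) ∨
    (∀ A ⊆ E, A.card ≤ ∑ t, f t {a ∈ A | t ∈ Function.update C e ((C e).erase j) a}) := by
  by_contra! hcon
  obtain ⟨⟨A, hA, hA'⟩, ⟨B, hB, hB'⟩⟩ := hcon
  have key : ∀ (A : Finset β) (t : ι), A ⊆ E →
      ∑ s, f s {a ∈ A | s ∈ Function.update C e ((C e).erase t) a} < A.card → e ∈ A := by
    intro A t hA hlt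
    by_contra he
    refine absurd (hC A hA) (not_le.2 (lt_of_eq_of_lt ?_ hlt))
    refine Finset.sum_congr rfl fun s _ => congrArg _ (Finset.filter_congr fun a ha => ?_)
    rw [Function.update_of_ne (by rintro rfl; exact he ha)]
  have heA := key A i hA hA'
  have heB := key B j hB hB'
  have h1 := hC (A ∪ B) (Finset.union_subset hA hB)
  have h2 := hC ((A ∩ B).erase e)
    ((Finset.erase_subset _ _).trans (Finset.inter_subset_left.trans hA))
  -- Uncrossing. Since `i ≠ j`, the edge `e` keeps each of its colors in `A` or in `B`, so nothing
  -- is lost on the union; on the intersection `e` is discarded. The cardinalities then lose only 1,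
  -- while the two strict violations lose 2.
  have h3 : ∑ t, f t {a ∈ A ∪ B | t ∈ C a} + ∑ t, f t {a ∈ (A ∩ B).erase e | t ∈ C a} ≤
      ∑ t, f t {a ∈ A | t ∈ Function.update C e ((C e).erase i) a} +
      ∑ t, f t {a ∈ B | t ∈ Function.update C e ((C e).erase j) a} := by
    rw [← Finset.sum_add_distrib, ← Finset.sum_add_distrib]
    refine Finset.sum_le_sum fun t _ => le_trans (add_le_add ?_ ?_) (hsub t _ _)
    · refine hmono t fun a ha => ?_
      by_cases hae : a = e
      · subst hae
        simp only [Finset.mem_filter, Finset.mem_union, Function.update_self,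
          Finset.mem_erase] at ha ⊢
        by_cases hti : t = i
        · subst hti; exact Or.inr ⟨heB, hij, ha.2⟩
        · exact Or.inl ⟨heA, hti, ha.2⟩
      · simp only [Finset.mem_filter, Finset.mem_union, Function.update_of_ne hae] at ha ⊢
        tauto
    · refine hmono t fun a ha => ?_
      simp only [Finset.mem_filter, Finset.mem_erase, Finset.mem_inter] at ha ⊢
      rw [Function.update_of_ne ha.1.1, Function.update_of_ne ha.1.1]
      tauto
  have h4 := Finset.card_union_add_card_inter A B
  have h5 := Finset.card_erase_add_one (Finset.mem_inter.2 ⟨heA, heB⟩)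
  omega

open Classical in
/-- A partition theorem for monotone submodular functions, in the style of matroid union. -/
theorem exists_partition_of_submodular {ι β : Type*} [Fintype ι] (f : ι → Finset β → ℕ)
    (hmono : ∀ j, Monotone (f j)) (hempty : ∀ j, f j ∅ = 0)
    (hsub : ∀ j A B, f j (A ∪ B) + f j (A ∩ B) ≤ f j A + f j B) (E : Finset β)
    (hE : ∀ A ⊆ E, A.card ≤ ∑ j, f j A) :
    ∃ P : ι → Finset β, (∀ j, P j ⊆ E) ∧ (∀ e ∈ E, ∃ j, e ∈ P j) ∧
      Pairwise (fun i j => Disjoint (P i) (P j)) ∧ ∀ j, ∀ A ⊆ P j, A.card ≤ f j A := by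
  have hex : ∃ C : β → Finset ι, ∀ A ⊆ E, A.card ≤ ∑ j, f j {a ∈ A | j ∈ C a} :=
    ⟨fun _ => Finset.univ, by simpa using hE⟩
  -- Lists of minimal total size have at most one color each, by `exists_erase_color`. They are
  -- nonempty on `E` because the condition for a singleton would otherwise read `1 ≤ 0`.
  obtain ⟨C, hC, hmin⟩ := (measure fun C : β → Finset ι => ∑ e ∈ E, (C e).card).wf.has_min
    {C | ∀ A ⊆ E, A.card ≤ ∑ j, f j {a ∈ A | j ∈ C a}} hex
  have hone : ∀ e ∈ E, ∀ i ∈ C e, ∀ j ∈ C e, i = j := by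
    intro e he i hi j hj
    by_contra hij
    have hlt : ∀ t ∈ C e, ∑ a ∈ E, (Function.update C e ((C e).erase t) a).card <
        ∑ a ∈ E, (C a).card := by
      intro t ht
      refine Finset.sum_lt_sum (fun a _ => ?_) ⟨e, he, ?_⟩
      · by_cases hae : a = e
        · subst hae; simpa using Finset.card_le_card (Finset.erase_subset t (C a))
        · rw [Function.update_of_ne hae]
      · rw [Function.update_self]; exact Finset.card_erase_lt_of_mem ht
    rcases exists_erase_color f hmono hsub E C hC e hij with h | h
    · exact hmin _ h (hlt i hi)
    · exact hmin _ h (hlt j hj)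
  refine ⟨fun j => {e ∈ E | j ∈ C e}, fun j => Finset.filter_subset _ _, fun e he => ?_, ?_, ?_⟩
  · by_contra! hno
    have hnil : ∀ j, j ∉ C e := fun j hj => hno j (Finset.mem_filter.2 ⟨he, hj⟩)
    have := hC {e} (by simpa using he)
    simp [Finset.filter_singleton, hnil, hempty] at this
  · intro i j hij
    refine Finset.disjoint_left.2 fun e hi hj => hij ?_
    rw [Finset.mem_filter] at hi hj
    exact hone e hi.1 i hi.2 j hj.2
  · intro j A hA
    have hA' : ∀ a ∈ A, a ∈ E ∧ j ∈ C a := fun a ha => Finset.mem_filter.1 (hA ha)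
    refine (hC A fun a ha => (hA' a ha).1).trans ?_
    rw [Finset.sum_eq_single j]
    · exact hmono j (Finset.filter_subset _ _)
    · intro i _ hij
      rw [Finset.filter_eq_empty_iff.2, hempty]
      exact fun a ha hi => hij (hone a (hA' a ha).1 i hi j (hA' a ha).2)
    · simp

/-! ### The cycle matroid, represented over the field with two elements. -/

namespace Graph

variable {α β : Type*}

/-- In characteristic 2 no orientation is needed, so the vector does not depend on the order of the
ends. The value 0 off `E(G)` spares later lemmas the assumption that `A` consists of edges. -/
theorem exists_edgeVec (G : Graph α β) (e : β) : ∃ w : α →₀ ZMod 2,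
    (∀ x y, G.IsLink e x y → w = Finsupp.single x 1 + Finsupp.single y 1) ∧
    (e ∉ E(G) → w = 0) := by
  by_cases he : e ∈ E(G)
  · obtain ⟨x, y, hxy⟩ := G.exists_isLink_of_mem_edgeSet he
    refine ⟨Finsupp.single x 1 + Finsupp.single y 1, fun z w hzw => ?_, fun h => absurd he h⟩
    obtain ⟨rfl, rfl⟩ | ⟨rfl, rfl⟩ := hxy.eq_and_eq_or_eq_and_eq hzw
    · rfl
    · exact add_comm _ _
  · exact ⟨0, fun x y h => absurd h.edge_mem he, fun _ => rfl⟩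

/-- The incidence vector of an edge over the field with two elements (zero for a loop). -/
noncomputable def edgeVec (G : Graph α β) (e : β) : α →₀ ZMod 2 :=
  (G.exists_edgeVec e).choose

theorem IsLink.edgeVec_eq {G : Graph α β} {e : β} {x y : α} (h : G.IsLink e x y) :
    G.edgeVec e = Finsupp.single x 1 + Finsupp.single y 1 :=
  (G.exists_edgeVec e).choose_spec.1 x y h

theorem edgeVec_of_notMem {G : Graph α β} {e : β} (h : e ∉ E(G)) : G.edgeVec e = 0 :=
  (G.exists_edgeVec e).choose_spec.2 h

/-- The span of the incidence vectors of a set of edges. -/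
noncomputable def edgeSpan (G : Graph α β) (A : Set β) : Submodule (ZMod 2) (α →₀ ZMod 2) :=
  Submodule.span (ZMod 2) (G.edgeVec '' A)

/-- The rank of a set of edges in the cycle matroid. -/
noncomputable def edgeRank (G : Graph α β) (A : Set β) : ℕ :=
  Module.finrank (ZMod 2) (G.edgeSpan A)

/-- The linear functional that adds up the coordinates in `C`. -/
noncomputable def sumOn (C : Set α) : (α →₀ ZMod 2) →ₗ[ZMod 2] ZMod 2 :=
  Finsupp.linearCombination (ZMod 2) (C.indicator 1)

theorem sumOn_single_of_mem {C : Set α} {x : α} (h : x ∈ C) :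
    sumOn C (Finsupp.single x 1) = 1 := by
  simp [sumOn, h]

theorem sumOn_single_of_notMem {C : Set α} {x : α} (h : x ∉ C) :
    sumOn C (Finsupp.single x 1) = 0 := by
  simp [sumOn, h]

theorem finiteDimensional_edgeSpan (G : Graph α β) {A : Set β} (hA : A.Finite) :
    FiniteDimensional (ZMod 2) (G.edgeSpan A) :=
  FiniteDimensional.span_of_finite _ (hA.image _)

theorem edgeSpan_mono (G : Graph α β) {A B : Set β} (h : A ⊆ B) : G.edgeSpan A ≤ G.edgeSpan B :=
  Submodule.span_mono (Set.image_mono h)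

theorem edgeRank_mono (G : Graph α β) {A B : Set β} (hB : B.Finite) (h : A ⊆ B) :
    G.edgeRank A ≤ G.edgeRank B := by
  have := G.finiteDimensional_edgeSpan hB
  exact Submodule.finrank_mono (G.edgeSpan_mono h)

theorem edgeRank_empty (G : Graph α β) : G.edgeRank ∅ = 0 := by
  rw [edgeRank, edgeSpan, Set.image_empty, Submodule.span_empty, finrank_bot]

theorem edgeRank_union_add_inter_le (G : Graph α β) {A B : Set β} (hA : A.Finite)
    (hB : B.Finite) :
    G.edgeRank (A ∪ B) + G.edgeRank (A ∩ B) ≤ G.edgeRank A + G.edgeRank B := by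
  have := G.finiteDimensional_edgeSpan hA
  have := G.finiteDimensional_edgeSpan hB
  have h1 : G.edgeSpan (A ∪ B) = G.edgeSpan A ⊔ G.edgeSpan B := by
    rw [edgeSpan, Set.image_union, Submodule.span_union]; rfl
  have h2 : G.edgeSpan (A ∩ B) ≤ G.edgeSpan A ⊓ G.edgeSpan B :=
    le_inf (G.edgeSpan_mono Set.inter_subset_left) (G.edgeSpan_mono Set.inter_subset_right)
  have h3 := Submodule.finrank_mono h2
  have h4 := Submodule.finrank_sup_add_finrank_inf_eq (G.edgeSpan A) (G.edgeSpan B)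
  unfold edgeRank
  rw [h1]
  omega

/-- If no edge of `A` leaves `C`, then `sumOn C` vanishes on the span of `A`. -/
theorem edgeSpan_le_ker_sumOn (G : Graph α β) {A : Set β} {C : Set α}
    (hC : ∀ e ∈ A, ∀ x y, G.IsLink e x y → (x ∈ C ↔ y ∈ C)) :
    G.edgeSpan A ≤ LinearMap.ker (sumOn C) := by
  refine Submodule.span_le.2 ?_
  rintro _ ⟨e, he, rfl⟩
  rw [SetLike.mem_coe, LinearMap.mem_ker]
  by_cases heG : e ∈ E(G)
  · obtain ⟨x, y, hxy⟩ := G.exists_isLink_of_mem_edgeSet heG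
    have := hC e he x y hxy
    rw [hxy.edgeVec_eq, map_add]
    by_cases hx : x ∈ C
    · rw [sumOn_single_of_mem hx, sumOn_single_of_mem (this.1 hx)]; rfl
    · rw [sumOn_single_of_notMem hx, sumOn_single_of_notMem (mt this.2 hx), add_zero]
  · rw [edgeVec_of_notMem heG, map_zero]

theorem edgeSpan_le_supported (G : Graph α β) {A : Set β} {W : Set α}
    (hW : ∀ e ∈ A, ∀ x y, G.IsLink e x y → x ∈ W) :
    G.edgeSpan A ≤ Finsupp.supported (ZMod 2) (ZMod 2) W := by
  refine Submodule.span_le.2 ?_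
  rintro _ ⟨e, he, rfl⟩
  by_cases heG : e ∈ E(G)
  · obtain ⟨x, y, hxy⟩ := G.exists_isLink_of_mem_edgeSet heG
    rw [hxy.edgeVec_eq]
    exact add_mem (Finsupp.single_mem_supported _ _ (hW e he x y hxy))
      (Finsupp.single_mem_supported _ _ (hW e he y x hxy.symm))
  · rw [edgeVec_of_notMem heG]
    exact zero_mem _

/-- Summing the edge vectors along a walk, inner vertices occur twice and cancel. -/
theorem single_add_single_mem_edgeSpan (G : Graph α β) {A : Set β} {x y : α}
    (h : Relation.ReflTransGen (G.restrict A).Adj x y) :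
    Finsupp.single x 1 + Finsupp.single y 1 ∈ G.edgeSpan A := by
  have htwo : ∀ z : α, (Finsupp.single z 1 + Finsupp.single z 1 : α →₀ ZMod 2) = 0 := fun z => by
    rw [← Finsupp.single_add]
    exact Finsupp.single_eq_zero.2 rfl
  induction h with
  | refl => rw [htwo]; exact zero_mem _
  | @tail b c _ hbc ih =>
    obtain ⟨e, he⟩ := hbc
    rw [restrict_isLink] at he
    have h1 : G.edgeVec e ∈ G.edgeSpan A := Submodule.subset_span ⟨e, by tauto, rfl⟩
    rw [IsLink.edgeVec_eq (x := b) (y := c) (by tauto)] at h1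
    have := add_mem ih h1
    rwa [add_assoc, ← add_assoc (Finsupp.single b 1), htwo, zero_add] at this

theorem finrank_supported (W : Finset α) :
    Module.finrank (ZMod 2) (Finsupp.supported (ZMod 2) (ZMod 2) (W : Set α)) = W.card := by
  rw [LinearEquiv.finrank_eq (Finsupp.supportedEquivFinsupp (W : Set α))]
  simp

theorem finiteDimensional_supported (W : Finset α) :
    FiniteDimensional (ZMod 2) (Finsupp.supported (ZMod 2) (ZMod 2) (W : Set α)) :=
  FiniteDimensional.of_injective
    (Finsupp.supportedEquivFinsupp (M := ZMod 2) (R := ZMod 2) (W : Set α)).toLinearMap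
    (LinearEquiv.injective _)

/-- If `A` connects `x₀` to all vertices of `W`, then it has rank at least `|W| - 1`. -/
theorem card_le_edgeRank_add_one (G : Graph α β) {A : Set β} (hA : A.Finite) {W : Finset α}
    {x₀ : α} (h : ∀ x ∈ W, Relation.ReflTransGen (G.restrict A).Adj x₀ x) :
    W.card ≤ G.edgeRank A + 1 := by
  have := G.finiteDimensional_edgeSpan hA
  -- Once `single x₀ 1` is adjoined, the walks from `x₀` yield the basis vector of every vertex of
  -- `W`, at the cost of one dimension.
  have hle : Finsupp.supported (ZMod 2) (ZMod 2) (W : Set α) ≤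
      G.edgeSpan A ⊔ Submodule.span (ZMod 2) {Finsupp.single x₀ 1} := by
    rw [Finsupp.supported_eq_span_single, Submodule.span_le]
    rintro _ ⟨x, hx, rfl⟩
    have h1 := G.single_add_single_mem_edgeSpan (h x hx)
    have h2 : (Finsupp.single x₀ 1 : α →₀ ZMod 2) ∈
      Submodule.span (ZMod 2) {(Finsupp.single x₀ 1 : α →₀ ZMod 2)} :=
        Submodule.mem_span_singleton_self _
    have := sub_mem (Submodule.mem_sup_left h1) (Submodule.mem_sup_right (S := G.edgeSpan A) h2)
    rwa [add_sub_cancel_left] at this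
  have h1 := Submodule.finrank_mono hle
  rw [finrank_supported] at h1
  have h2 := Submodule.finrank_add_le_finrank_add_finrank (G.edgeSpan A)
    (Submodule.span (ZMod 2) {(Finsupp.single x₀ 1 : α →₀ ZMod 2)})
  have h3 : Module.finrank (ZMod 2)
      (Submodule.span (ZMod 2) {(Finsupp.single x₀ 1 : α →₀ ZMod 2)}) ≤ 1 := by
    have := finrank_span_finset_le_card (R := ZMod 2)
      ({Finsupp.single x₀ 1} : Finset (α →₀ ZMod 2))
    rwa [Set.finrank, Finset.coe_singleton, Finset.card_singleton] at this
  unfold edgeRank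
  omega

/-- The rank of a set of edges on a nonempty vertex set `W` is at most `|W| - 1`. -/
theorem edgeRank_add_one_le_card (G : Graph α β) {A : Set β} {W : Finset α}
    (hW : ∀ e ∈ A, ∀ x y, G.IsLink e x y → x ∈ W) (hne : W.Nonempty) :
    G.edgeRank A + 1 ≤ W.card := by
  have := finiteDimensional_supported W
  obtain ⟨x, hx⟩ := hne
  have hlt : G.edgeSpan A < Finsupp.supported (ZMod 2) (ZMod 2) (W : Set α) := by
    refine lt_of_le_of_ne (G.edgeSpan_le_supported hW) fun heq => ?_
    have h1 : Finsupp.single x 1 ∈ G.edgeSpan A := heq ▸ Finsupp.single_mem_supported _ _ hx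
    have h2 := G.edgeSpan_le_ker_sumOn (A := A) (C := Set.univ) (by simp) h1
    rw [LinearMap.mem_ker, sumOn_single_of_mem (Set.mem_univ x)] at h2
    exact one_ne_zero h2
  have := Submodule.finrank_lt_finrank_of_lt hlt
  rwa [finrank_supported] at this

/-- The rank of a set of edges on `W` is at most `|W| - 2` if two vertices of `W` are not
connected. -/
theorem edgeRank_add_two_le_card (G : Graph α β) {A : Set β} {W : Finset α}
    (hW : ∀ e ∈ A, ∀ x y, G.IsLink e x y → x ∈ W) {x y : α} (hx : x ∈ W) (hy : y ∈ W)
    (hxy : ¬ Relation.ReflTransGen (G.restrict A).Adj x y) :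
    G.edgeRank A + 2 ≤ W.card := by
  have := finiteDimensional_supported W
  have hle : G.edgeSpan A ⊔ Submodule.span (ZMod 2) {Finsupp.single x 1} ≤
      Finsupp.supported (ZMod 2) (ZMod 2) (W : Set α) :=
    sup_le (G.edgeSpan_le_supported hW)
      (Submodule.span_le.2 (by simpa using Finsupp.single_mem_supported _ _ hx))
  have := Submodule.finiteDimensional_of_le hle
  -- Edge vectors have coordinate sum 0, whereas `single x 1` has coordinate sum 1.
  have h1 : G.edgeSpan A < G.edgeSpan A ⊔ Submodule.span (ZMod 2) {Finsupp.single x 1} := by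
    refine lt_of_le_of_ne le_sup_left fun heq => ?_
    have h1 : Finsupp.single x 1 ∈ G.edgeSpan A :=
      heq ▸ Submodule.mem_sup_right (Submodule.mem_span_singleton_self _)
    have h2 := G.edgeSpan_le_ker_sumOn (A := A) (C := Set.univ) (by simp) h1
    rw [LinearMap.mem_ker, sumOn_single_of_mem (Set.mem_univ x)] at h2
    exact one_ne_zero h2
  have h2 : G.edgeSpan A ⊔ Submodule.span (ZMod 2) {Finsupp.single x 1} <
      Finsupp.supported (ZMod 2) (ZMod 2) (W : Set α) := by
    refine lt_of_le_of_ne hle fun heq => ?_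
    -- `sumOn C` vanishes on the edges of `A`, which do not leave `C`, and on `single x 1`, but not
    -- on `single y 1`. This makes the second inclusion strict as well.
    set C : Set α := {z | ¬ Relation.ReflTransGen (G.restrict A).Adj x z} with hC
    have h1 : G.edgeSpan A ⊔ Submodule.span (ZMod 2) {Finsupp.single x 1} ≤
        LinearMap.ker (sumOn C) := by
      refine sup_le (G.edgeSpan_le_ker_sumOn fun e he a b hab => ?_) (Submodule.span_le.2 ?_)
      · have hab' : (G.restrict A).Adj a b := ⟨e, by rw [restrict_isLink]; tauto⟩
        exact not_congr ⟨fun h => h.tail hab', fun h => h.tail hab'.symm⟩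
      · rw [Set.singleton_subset_iff, SetLike.mem_coe, LinearMap.mem_ker]
        exact sumOn_single_of_notMem fun h => h .refl
    have h3 : Finsupp.single y 1 ∈ LinearMap.ker (sumOn C) :=
      h1 (heq ▸ Finsupp.single_mem_supported _ _ hy)
    rw [LinearMap.mem_ker, sumOn_single_of_mem hxy] at h3
    exact one_ne_zero h3
  have h3 := Submodule.finrank_lt_finrank_of_lt h1
  have h4 := Submodule.finrank_lt_finrank_of_lt h2
  rw [finrank_supported] at h4
  unfold edgeRank
  omega

/-- The edges of a graph without cycles have linearly independent incidence vectors. -/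
theorem linearIndepOn_edgeVec_of_acyclic (G : Graph α β)
    (h : ∀ (n : ℕ) (v : Fin (n + 1) → α) (e : Fin (n + 1) → β), ¬ G.IsCycle v e) :
    LinearIndepOn (ZMod 2) G.edgeVec E(G) := by
  rw [linearIndepOn_iff_notMem_span]
  intro e he hmem
  obtain ⟨x, y, hxy⟩ := G.exists_isLink_of_mem_edgeSet he
  change G.edgeVec e ∈ G.edgeSpan (E(G) \ {e}) at hmem
  -- Otherwise the coordinate sum over the component of `x` would vanish on the other edges but not
  -- on `e`.
  have hconn : Relation.ReflTransGen (G.restrict (E(G) \ {e})).Adj x y := by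
    by_contra hcon
    have h1 := G.edgeSpan_le_ker_sumOn (A := E(G) \ {e})
      (C := {z | Relation.ReflTransGen (G.restrict (E(G) \ {e})).Adj x z}) (fun f hf a b hab => by
        have hab' : (G.restrict (E(G) \ {e})).Adj a b := ⟨f, by rw [restrict_isLink]; tauto⟩
        exact ⟨fun h => h.tail hab', fun h => h.tail hab'.symm⟩) hmem
    rw [LinearMap.mem_ker, hxy.edgeVec_eq, map_add, sumOn_single_of_mem (by exact .refl),
      sumOn_single_of_notMem (by exact hcon), add_zero] at h1
    exact one_ne_zero h1
  obtain ⟨n, w, rfl, rfl, hr, hinj⟩ := hconn.exists_injOn_path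
  have : Nonempty β := ⟨e⟩
  choose! f hf using hr
  simp only [restrict_isLink, Set.mem_sdiff, Set.mem_singleton_iff] at hf
  -- A path from `x` to `y` avoiding `e` is closed up by `e` at the last index. If `e` is a loop
  -- then `n = 0` and the cycle is `e` alone.
  refine h n (fun i => w i) (fun i => if (i : ℕ) < n then f i else e) ⟨?_, ?_, ?_⟩
  · intro i j hij
    exact Fin.ext (hinj (Nat.lt_succ_iff.1 i.2) (Nat.lt_succ_iff.1 j.2) hij)
  · intro i j hij
    have hi := i.2
    have hj := j.2
    refine Fin.ext ?_
    simp only at hij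
    split_ifs at hij with h1 h2 h2
    · have hfi := (hf i h1)
      have hfj := (hf j h2)
      rw [hij] at hfi
      have hII : ∀ {a b : ℕ}, a ≤ n → b ≤ n → w a = w b → a = b := fun ha hb => hinj ha hb
      rcases IsLink.eq_and_eq_or_eq_and_eq (G := G) (e := f j) (x := w i) (y := w (i + 1))
          (x' := w j) (y' := w (j + 1)) (by tauto) (by tauto) with h | h
      · exact hII h1.le h2.le h.1
      · have a1 := hII h1.le h2 h.1
        have a2 := hII h1 h2.le h.2
        omega
    · exact absurd hij (by have := hf i h1; tauto)
    · exact absurd hij.symm (by have := hf j h2; tauto)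
    · omega
  · intro i
    induction i using Fin.lastCases with
    | last => simpa using hxy.symm
    | cast i =>
      have := hf i i.2
      simp only [Fin.val_castSucc, i.2, if_true, Fin.coeSucc_eq_succ, Fin.val_succ]
      tauto

/-- A set of edges whose incidence vectors are linearly independent contains no cycle. -/
theorem not_isCycle_of_linearIndepOn (G : Graph α β) {A : Set β}
    (hA : LinearIndepOn (ZMod 2) G.edgeVec A) {n : ℕ} (v : Fin (n + 1) → α)
    (e : Fin (n + 1) → β) : ¬ (G.restrict A).IsCycle v e := by
  rintro ⟨-, he, hl⟩
  simp only [restrict_isLink] at hl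
  have hli : LinearIndependent (ZMod 2) (fun i => G.edgeVec (e i)) :=
    LinearIndependent.comp hA (fun i => (⟨e i, by have := hl i; tauto⟩ : A))
      fun i j hij => he (congrArg Subtype.val hij)
  have hsum : ∑ i, (1 : ZMod 2) • G.edgeVec (e i) = 0 := by
    have h1 : ∀ i, (1 : ZMod 2) • G.edgeVec (e i) =
        Finsupp.single (v i) 1 + Finsupp.single (v (i + 1)) 1 := fun i => by
      rw [one_smul]
      exact IsLink.edgeVec_eq (by have := hl i; tauto)
    -- The cyclic shift permutes the indices, so each vertex of the cycle is counted twice.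
    have h2 : ∑ i, Finsupp.single (v (i + 1)) (1 : ZMod 2) = ∑ i, Finsupp.single (v i) 1 :=
      Equiv.sum_comp (Equiv.addRight (1 : Fin (n + 1))) fun i => Finsupp.single (v i) (1 : ZMod 2)
    rw [Finset.sum_congr rfl fun i _ => h1 i, Finset.sum_add_distrib, h2, ← two_smul (ZMod 2)]
    exact zero_smul _ _
  exact one_ne_zero (Fintype.linearIndependent_iff.1 hli (fun _ => 1) hsum 0)

theorem linearIndepOn_edgeVec_iff_ncard_le (G : Graph α β) {A : Set β} (hA : A.Finite) :
    LinearIndepOn (ZMod 2) G.edgeVec A ↔ A.ncard ≤ G.edgeRank A := by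
  have := hA.fintype
  rw [LinearIndepOn, linearIndependent_iff_card_le_finrank_span, ← Nat.card_eq_fintype_card,
    Nat.card_coe_set_eq, ← Set.image_eq_range]
  rfl

end Graph

/-! ### Maps-and-trees are tight. -/

open Classical in
theorem Set.ncard_eq_sum_ncard_inter {ι β : Type*} [Fintype ι] {X : Set β} (hX : X.Finite)
    {F : ι → Set β} (hF : Pairwise fun a b => Disjoint (F a) (F b)) (hXF : X ⊆ ⋃ a, F a) :
    X.ncard = ∑ a, (X ∩ F a).ncard := by
  have h1 : hX.toFinset = Finset.univ.biUnion fun a => {e ∈ hX.toFinset | e ∈ F a} := by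
    ext e
    simp only [Set.Finite.mem_toFinset, Finset.mem_biUnion, Finset.mem_univ, true_and,
      Finset.mem_filter, exists_and_left, iff_self_and]
    exact fun he => Set.mem_iUnion.1 (hXF he)
  rw [Set.ncard_eq_toFinset_card X hX, h1, Finset.card_biUnion]
  · refine Finset.sum_congr rfl fun a _ => ?_
    rw [← Set.ncard_coe_finset]
    congr 1
    ext e
    simp
  · intro a _ b _ hab
    refine Finset.disjoint_left.2 fun e ha hb => ?_
    exact Set.disjoint_left.1 (hF hab) (Finset.mem_filter.1 ha).2 (Finset.mem_filter.1 hb).2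

namespace Graph

variable {α β : Type*}

theorem IsTree.linearIndepOn {T : Graph α β} (hT : T.IsTree) :
    LinearIndepOn (ZMod 2) T.edgeVec E(T) :=
  T.linearIndepOn_edgeVec_of_acyclic hT.2

theorem IsTree.ncard_add_one_le {T : Graph α β} (hT : T.IsTree) {A : Set β} (hA : A.Finite)
    (hAT : A ⊆ E(T)) {W : Finset α} (hW : ∀ e ∈ A, ∀ x y, T.IsLink e x y → x ∈ W)
    (hne : W.Nonempty) : A.ncard + 1 ≤ W.card :=
  (Nat.add_le_add_right ((T.linearIndepOn_edgeVec_iff_ncard_le hA).1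
    (hT.linearIndepOn.mono hAT)) 1).trans (T.edgeRank_add_one_le_card hW hne)

theorem IsTree.ncard_edgeSet_add_one {T : Graph α β} (hT : T.IsTree) (hE : E(T).Finite)
    (hV : V(T).Finite) : E(T).ncard + 1 = V(T).ncard := by
  obtain ⟨⟨x, hx⟩, hconn⟩ := hT.1
  rw [Set.ncard_eq_toFinset_card _ hV]
  refine le_antisymm (hT.ncard_add_one_le hE subset_rfl
    (fun e _ x y h => hV.mem_toFinset.2 h.left_mem) ⟨x, hV.mem_toFinset.2 hx⟩) ?_
  refine (T.card_le_edgeRank_add_one hE (x₀ := x) fun y hy => ?_).trans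
    (Nat.add_le_add_right ?_ 1)
  · rw [restrict_self]
    exact hconn x hx y (hV.mem_toFinset.1 hy)
  · have := hE.fintype
    rw [edgeRank, edgeSpan, Set.image_eq_range, ← Nat.card_coe_set_eq, Nat.card_eq_fintype_card]
    exact finrank_range_le_card _

theorem Orientation.bijective_tail {M : Graph α β} {o : M.Orientation}
    (ho : ∀ v ∈ V(M), o.outDegree v = 1) :
    Function.Bijective fun e : E(M) => (⟨o.tail e, (o.isLink e).left_mem⟩ : V(M)) := by
  constructor
  · intro e f hef
    obtain ⟨g, hg⟩ := Set.ncard_eq_one.1 (ho _ (o.isLink e).left_mem)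
    have he : e ∈ ({g} : Set E(M)) := hg ▸ rfl
    have hf : f ∈ ({g} : Set E(M)) := hg ▸ (congrArg Subtype.val hef).symm
    rw [Set.mem_singleton_iff] at he hf
    rw [he, hf]
  · rintro ⟨v, hv⟩
    obtain ⟨g, hg⟩ := Set.ncard_eq_one.1 (ho v hv)
    have hgv : g ∈ {e : E(M) | o.tail e = v} := hg ▸ rfl
    exact ⟨g, Subtype.ext hgv⟩

theorem IsMapGraph.ncard_edgeSet {M : Graph α β} (hM : M.IsMapGraph) :
    E(M).ncard = V(M).ncard := by
  obtain ⟨o, ho⟩ := hM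
  rw [← Nat.card_coe_set_eq, ← Nat.card_coe_set_eq]
  exact Nat.card_eq_of_bijective _ (Orientation.bijective_tail ho)

theorem IsMapGraph.ncard_le {M : Graph α β} (hM : M.IsMapGraph) {A : Set β}
    (hAM : A ⊆ E(M)) {W : Finset α} (hW : ∀ e ∈ A, ∀ x y, M.IsLink e x y → x ∈ W) :
    A.ncard ≤ W.card := by
  obtain ⟨o, ho⟩ := hM
  rw [← Set.ncard_coe_finset, ← Nat.card_coe_set_eq, ← Nat.card_coe_set_eq]
  refine Nat.card_le_card_of_injective (α := A) (β := (W : Set α)) (fun a =>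
    ⟨o.tail ⟨a, hAM a.2⟩, hW a a.2 _ _ (o.isLink ⟨a, hAM a.2⟩)⟩) fun a b hab => ?_
  have htail : o.tail ⟨a, hAM a.2⟩ = o.tail ⟨b, hAM b.2⟩ := by simpa using hab
  have := (Orientation.bijective_tail ho).1 (Subtype.ext htail)
  exact Subtype.ext (by simpa using this)

theorem IsMapsAndTrees.isTight {G : Graph α β} {k ℓ : ℕ} (hℓ : ℓ ≤ k) (hV : V(G).Finite)
    (hE : E(G).Finite) (h : G.IsMapsAndTrees k ℓ) : G.IsTight k ℓ := by
  obtain ⟨T, M, hT, hM, hdisj, hunion⟩ := h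
  obtain ⟨d, rfl⟩ := Nat.exists_eq_add_of_le hℓ
  constructor
  · intro H hHG hne
    have hVH := hV.subset hHG.vertexSet_mono
    have hEH := hE.subset hHG.edgeSet_mono
    have hne' : hVH.toFinset.Nonempty := by
      obtain ⟨e, he⟩ := hne
      obtain ⟨x, y, hxy⟩ := H.exists_isLink_of_mem_edgeSet he
      exact ⟨x, hVH.mem_toFinset.2 hxy.left_mem⟩
    have hmem : ∀ S ≤ G, ∀ e ∈ E(H) ∩ E(S), ∀ x y, S.IsLink e x y → x ∈ hVH.toFinset := by
      intro S hS e he x y hxy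
      exact hVH.mem_toFinset.2 ((IsSubgraph.isLink_iff hHG he.1).2 (hxy.mono hS)).left_mem
    have h1 := fun j => (hT j).2.ncard_add_one_le (hEH.inter_of_left E(T j))
      Set.inter_subset_right (hmem _ (hT j).1.le) hne'
    have h2 := fun i => (hM i).2.ncard_le Set.inter_subset_right (hmem _ (hM i).1.le)
    have h3 := Set.ncard_eq_sum_ncard_inter hEH hdisj (hunion ▸ hHG.edgeSet_mono)
    rw [Fintype.sum_sum_type] at h3
    simp only [Sum.elim_inl, Sum.elim_inr] at h3
    have h4 := Finset.sum_le_sum fun j (_ : j ∈ Finset.univ) => h1 j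
    have h5 := Finset.sum_le_sum fun i (_ : i ∈ Finset.univ) => h2 i
    simp only [Finset.sum_add_distrib, Finset.sum_const, Finset.card_univ, Fintype.card_fin,
      smul_eq_mul, mul_one, Nat.add_sub_cancel_left] at h4 h5
    rw [← Set.ncard_eq_toFinset_card _ hVH] at h4 h5
    have h6 := add_mul ℓ d V(H).ncard
    have h7 : E(H).ncard + ℓ ≤ (ℓ + d) * V(H).ncard := by omega
    have h8 : ((E(H).ncard + ℓ : ℕ) : ℤ) ≤ ((ℓ + d) * V(H).ncard : ℕ) := by exact_mod_cast h7
    push_cast at h8 ⊢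
    linarith
  · have h1 : ∀ j, E(T j).ncard + 1 = V(G).ncard := fun j => by
      rw [← (hT j).1.vertexSet_eq]
      exact (hT j).2.ncard_edgeSet_add_one (hE.subset (hT j).1.le.edgeSet_mono)
        (hV.subset (hT j).1.le.vertexSet_mono)
    have h2 : ∀ i, E(M i).ncard = V(G).ncard := fun i => by
      rw [← (hM i).1.vertexSet_eq, (hM i).2.ncard_edgeSet]
    have h3 := Set.ncard_eq_sum_ncard_inter hE hdisj hunion.subset
    have hT' : ∀ j, E(G) ∩ E(T j) = E(T j) := fun j =>
      Set.inter_eq_right.2 (hT j).1.le.edgeSet_mono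
    have hM' : ∀ i, E(G) ∩ E(M i) = E(M i) := fun i =>
      Set.inter_eq_right.2 (hM i).1.le.edgeSet_mono
    rw [Fintype.sum_sum_type] at h3
    simp only [Sum.elim_inl, Sum.elim_inr, hT', hM', h2] at h3
    have h4 := Finset.sum_congr rfl fun j (_ : j ∈ (Finset.univ : Finset (Fin ℓ))) => h1 j
    simp only [Finset.sum_add_distrib, Finset.sum_const, Finset.card_univ, Fintype.card_fin,
      smul_eq_mul, mul_one, Nat.add_sub_cancel_left] at h3 h4
    have h6 := add_mul ℓ d V(G).ncard
    have h7 : E(G).ncard + ℓ = (ℓ + d) * V(G).ncard := by omega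
    have h8 : ((E(G).ncard + ℓ : ℕ) : ℤ) = ((ℓ + d) * V(G).ncard : ℕ) := by exact_mod_cast h7
    push_cast at h8 ⊢
    linarith

/-! ### Tight graphs decompose into trees and map-graphs. -/

theorem exists_ends (G : Graph α β) (e : β) : ∃ s : Finset α, ∀ v, v ∈ s ↔ G.Inc e v := by
  classical
  by_cases he : e ∈ E(G)
  · obtain ⟨x, y, hxy⟩ := G.exists_isLink_of_mem_edgeSet he
    refine ⟨{x, y}, fun v => ?_⟩
    rw [Finset.mem_insert, Finset.mem_singleton]
    refine ⟨?_, fun h => h.eq_or_eq_of_isLink hxy⟩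
    rintro (rfl | rfl)
    · exact hxy.inc_left
    · exact hxy.inc_right
  · exact ⟨∅, fun v => by simp [he]⟩

/-- The set of the ends of an edge. -/
noncomputable def ends (G : Graph α β) (e : β) : Finset α := (G.exists_ends e).choose

theorem mem_ends {G : Graph α β} {e : β} {v : α} : v ∈ G.ends e ↔ G.Inc e v :=
  (G.exists_ends e).choose_spec v

open Classical in
/-- The set of the vertices covered by a set of edges. -/
noncomputable def coveredVerts (G : Graph α β) (A : Finset β) : Finset α := A.biUnion G.ends

theorem mem_coveredVerts {G : Graph α β} {A : Finset β} {v : α} :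
    v ∈ G.coveredVerts A ↔ ∃ e ∈ A, G.Inc e v := by
  classical
  simp [coveredVerts, mem_ends]

theorem coveredVerts_mono (G : Graph α β) : Monotone G.coveredVerts := by
  intro A B h v hv
  rw [mem_coveredVerts] at hv ⊢
  obtain ⟨e, he, hv⟩ := hv
  exact ⟨e, h he, hv⟩

-- Covering turns unions into unions, but the vertices covered by an intersection are only contained
-- in the intersection of the covered sets.
open Classical in
theorem card_coveredVerts_union_add_inter_le (G : Graph α β) (A B : Finset β) :
    (G.coveredVerts (A ∪ B)).card + (G.coveredVerts (A ∩ B)).card ≤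
      (G.coveredVerts A).card + (G.coveredVerts B).card := by
  rw [← Finset.card_union_add_card_inter (G.coveredVerts A)]
  refine add_le_add (Finset.card_le_card fun v => ?_) (Finset.card_le_card fun v => ?_)
  · rw [Finset.mem_union]
    simp only [mem_coveredVerts, Finset.mem_union]
    rintro ⟨e, he | he, hv⟩
    · exact Or.inl ⟨e, he, hv⟩
    · exact Or.inr ⟨e, he, hv⟩
  · rw [Finset.mem_inter]
    simp only [mem_coveredVerts, Finset.mem_inter]
    rintro ⟨e, he, hv⟩
    exact ⟨⟨e, he.1, hv⟩, ⟨e, he.2, hv⟩⟩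

/-- The sparsity inequality for the subgraph formed by the edges `A` on a vertex set `W`. -/
theorem IsSparse.card_add_le {G : Graph α β} {k ℓ : ℕ} (hG : G.IsSparse k ℓ) {A : Finset β}
    (hAG : (A : Set β) ⊆ E(G)) (hne : A.Nonempty) {W : Finset α} (hWG : (W : Set α) ⊆ V(G))
    (hW : ∀ e ∈ A, ∀ x y, G.IsLink e x y → x ∈ W) : A.card + ℓ ≤ k * W.card := by
  -- Inducing on `W` keeps its isolated vertices, so the subgraph has exactly `|W|` vertices even if
  -- `A` covers fewer.
  have hE : E((G.restrict A).induce W) = A := by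
    ext e
    rw [edgeSet_induce]
    constructor
    · rintro ⟨x, y, h, -⟩
      rw [restrict_isLink] at h
      exact h.1
    · intro he
      obtain ⟨x, y, hxy⟩ := G.exists_isLink_of_mem_edgeSet (hAG he)
      exact ⟨x, y, by rw [restrict_isLink]; exact ⟨he, hxy⟩, hW e he x y hxy,
        hW e he y x hxy.symm⟩
  have := hG ((G.restrict A).induce W) ((induce_le (by simpa using hWG)).trans restrict_le)
    (by rw [hE]; exact hne)
  rw [hE, vertexSet_induce, Set.ncard_coe_finset, Set.ncard_coe_finset] at this
  have h : ((A.card + ℓ : ℕ) : ℤ) ≤ (k * W.card : ℕ) := by push_cast; linarith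
  exact_mod_cast h

/-- Ranks add up for sets of edges on disjoint vertex sets. -/
theorem edgeRank_add_le_of_disjoint (G : Graph α β) {A B D : Set β} (hD : D.Finite)
    (hAD : A ⊆ D) (hBD : B ⊆ D) {C : Set α} (hA : ∀ e ∈ A, ∀ x y, G.IsLink e x y → x ∈ C)
    (hB : ∀ e ∈ B, ∀ x y, G.IsLink e x y → x ∉ C) :
    G.edgeRank A + G.edgeRank B ≤ G.edgeRank D := by
  have := G.finiteDimensional_edgeSpan hD
  have := G.finiteDimensional_edgeSpan (hD.subset hAD)
  have := G.finiteDimensional_edgeSpan (hD.subset hBD)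
  have h1 : Disjoint (G.edgeSpan A) (G.edgeSpan B) :=
    (Finsupp.disjoint_supported_supported (disjoint_compl_right (a := C))).mono
      (G.edgeSpan_le_supported hA) (G.edgeSpan_le_supported hB)
  have h3 := Submodule.finrank_sup_add_finrank_inf_eq (G.edgeSpan A) (G.edgeSpan B)
  rw [h1.eq_bot, finrank_bot, add_zero] at h3
  unfold edgeRank
  rw [← h3]
  exact Submodule.finrank_mono (sup_le (G.edgeSpan_mono hAD) (G.edgeSpan_mono hBD))

/-- In a sparse graph every set of edges satisfies the union condition for `ℓ` cycle matroids and
`k - ℓ` bicircular matroids. -/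
theorem IsSparse.card_le_rank_add {G : Graph α β} {ℓ d : ℕ} (hG : G.IsSparse (ℓ + d) ℓ)
    (A : Finset β) (hAG : (A : Set β) ⊆ E(G)) :
    A.card ≤ ℓ * G.edgeRank A + d * (G.coveredVerts A).card := by
  classical
  induction A using Finset.strongInduction with
  | H A ih =>
  obtain rfl | ⟨e₀, he₀⟩ := A.eq_empty_or_nonempty
  · simp
  obtain ⟨x₀, y₀, hxy⟩ := G.exists_isLink_of_mem_edgeSet (hAG he₀)
  -- Split off the component of `e₀`. If it has `m` vertices, then sparsity bounds its edges by `(ℓ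
  -- + d) m - ℓ = ℓ (m - 1) + d m`, and `m - 1` is at most its rank. Rank and covered vertices add
  -- up over the two vertex-disjoint pieces, and the rest is smaller.
  set C : Set α := {z | Relation.ReflTransGen (G.restrict A).Adj x₀ z} with hC
  have hclosed : ∀ e ∈ A, ∀ x y, G.IsLink e x y → x ∈ C → y ∈ C := fun e he x y h hx =>
    Relation.ReflTransGen.tail hx ⟨e, by rw [restrict_isLink]; exact ⟨he, h⟩⟩
  set A₁ : Finset β := {e ∈ A | ∃ x ∈ C, G.Inc e x} with hA₁
  set A₂ : Finset β := {e ∈ A | ¬ ∃ x ∈ C, G.Inc e x} with hA₂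
  have hcard : A₁.card + A₂.card = A.card := Finset.card_filter_add_card_filter_not _
  have hs₁ : A₁ ⊆ A := Finset.filter_subset _ _
  have hs₂ : A₂ ⊆ A := Finset.filter_subset _ _
  have he₁ : e₀ ∈ A₁ := Finset.mem_filter.2 ⟨he₀, x₀, .refl, hxy.inc_left⟩
  have hin : ∀ e ∈ A₁, ∀ x y, G.IsLink e x y → x ∈ C := by
    intro e he x y h
    obtain ⟨heA, z, hz, w, hzw⟩ := Finset.mem_filter.1 he
    obtain ⟨rfl, rfl⟩ | ⟨rfl, rfl⟩ := h.eq_and_eq_or_eq_and_eq hzw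
    · exact hz
    · exact hclosed e heA _ _ hzw hz
  have hout : ∀ e ∈ A₂, ∀ x y, G.IsLink e x y → x ∉ C := fun e he x y h hx =>
    (Finset.mem_filter.1 he).2 ⟨x, hx, h.inc_left⟩
  have hconn : ∀ z ∈ C, Relation.ReflTransGen (G.restrict A₁).Adj x₀ z := by
    intro z hz
    induction hz with
    | refl => exact .refl
    | @tail b c hb hbc ihb =>
      obtain ⟨e, he⟩ := hbc
      rw [restrict_isLink] at he
      refine ihb.tail ⟨e, ?_⟩
      rw [restrict_isLink]
      exact ⟨Finset.mem_filter.2 ⟨he.1, b, hb, he.2.inc_left⟩, he.2⟩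
  have hr₁ : (G.coveredVerts A₁).card ≤ G.edgeRank A₁ + 1 := by
    refine G.card_le_edgeRank_add_one A₁.finite_toSet (x₀ := x₀) fun z hz => hconn z ?_
    obtain ⟨e, he, w, hzw⟩ := mem_coveredVerts.1 hz
    exact hin e he z w hzw
  have hrank := G.edgeRank_add_le_of_disjoint A.finite_toSet (Finset.coe_subset.2 hs₁)
    (Finset.coe_subset.2 hs₂) hin hout
  have hverts : (G.coveredVerts A₁).card + (G.coveredVerts A₂).card ≤
      (G.coveredVerts A).card := by
    rw [← Finset.card_union_of_disjoint]
    · exact Finset.card_le_card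
        (Finset.union_subset (G.coveredVerts_mono hs₁) (G.coveredVerts_mono hs₂))
    · refine Finset.disjoint_left.2 fun v h1 h2 => ?_
      obtain ⟨e, he, w, hvw⟩ := mem_coveredVerts.1 h1
      obtain ⟨e', he', w', hvw'⟩ := mem_coveredVerts.1 h2
      exact hout e' he' v w' hvw' (hin e he v w hvw)
  have hsp := hG.card_add_le ((Finset.coe_subset.2 hs₁).trans hAG) ⟨e₀, he₁⟩
    (W := G.coveredVerts A₁) (fun v hv => by
      obtain ⟨e, -, w, hvw⟩ := mem_coveredVerts.1 hv
      exact hvw.left_mem)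
    (fun e he x y h => mem_coveredVerts.2 ⟨e, he, h.inc_left⟩)
  have h2 := ih A₂ (Finset.ssubset_iff_of_subset hs₂ |>.2
    ⟨e₀, he₀, fun h => (Finset.mem_filter.1 h).2 ⟨x₀, .refl, hxy.inc_left⟩⟩)
    ((Finset.coe_subset.2 hs₂).trans hAG)
  have m1 := Nat.mul_le_mul_left ℓ hr₁
  have m2 := Nat.mul_le_mul_left ℓ hrank
  have m3 := Nat.mul_le_mul_left d hverts
  rw [mul_add] at m1 m2 m3
  rw [add_mul] at hsp
  omega

/-- A spanning set of edges of full rank `|V| - 1` and size `|V| - 1` forms a tree. -/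
theorem isTree_restrict_of_ncard_le_edgeRank {G : Graph α β} (hV : V(G).Finite) {A : Set β}
    (hA : A.Finite) (hrank : A.ncard ≤ G.edgeRank A) (hcard : A.ncard + 1 = V(G).ncard) :
    (G.restrict A).IsTree := by
  refine ⟨⟨?_, fun x hx y hy => ?_⟩, fun n v e =>
    G.not_isCycle_of_linearIndepOn ((G.linearIndepOn_edgeVec_iff_ncard_le hA).2 hrank) v e⟩
  · rw [vertexSet_restrict, ← Set.ncard_pos hV]
    omega
  · by_contra hcon
    have := G.edgeRank_add_two_le_card (A := A) (W := hV.toFinset)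
      (fun e _ x y h => hV.mem_toFinset.2 h.left_mem) (hV.mem_toFinset.2 hx)
      (hV.mem_toFinset.2 hy) hcon
    rw [← Set.ncard_eq_toFinset_card _ hV] at this
    omega

/-- A set of `|V|` edges that satisfies Hall's condition forms a spanning map-graph. -/
theorem isMapGraph_restrict_of_card_le {G : Graph α β} (hV : V(G).Finite) {A : Finset β}
    (hAG : (A : Set β) ⊆ E(G)) (hHall : ∀ B ⊆ A, B.card ≤ (G.coveredVerts B).card)
    (hcard : A.card = V(G).ncard) : (G.restrict A).IsMapGraph := by
  classical
  have hmem : ∀ e ∈ E(G.restrict A), e ∈ A := fun e he => by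
    rw [edgeSet_restrict] at he; exact he.2
  -- Distinct representatives among the ends serve as tails; equal cardinalities then make each
  -- vertex the tail of exactly one edge.
  obtain ⟨t, htinj, ht⟩ := (Finset.all_card_le_biUnion_card_iff_exists_injective
    fun e : E(G.restrict A) => G.ends e).1 fun s => by
      have := hHall (s.image Subtype.val) fun e he => by
        obtain ⟨e', -, rfl⟩ := Finset.mem_image.1 he
        exact hmem e' e'.2
      rwa [Finset.card_image_of_injective _ Subtype.val_injective, coveredVerts,
        Finset.image_biUnion] at this
  have hinc : ∀ e : E(G.restrict A), G.Inc e (t e) := fun e => mem_ends.1 (ht e)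
  refine ⟨⟨t, fun e => (hinc e).other, fun e => ?_⟩, fun v hv => ?_⟩
  · rw [restrict_isLink]
    exact ⟨hmem e e.2, (hinc e).isLink_other⟩
  · have := hV.to_subtype
    have hbij : Function.Bijective fun e : E(G.restrict A) =>
        (⟨t e, (hinc e).vertex_mem⟩ : V(G)) := by
      refine Function.Injective.bijective_of_nat_card_le
        (fun e f h => htinj (congrArg Subtype.val h)) ?_
      rw [Nat.card_coe_set_eq, Nat.card_coe_set_eq, edgeSet_restrict, Set.inter_eq_right.2 hAG,
        Set.ncard_coe_finset, hcard]
    obtain ⟨e, he⟩ := hbij.2 ⟨v, hv⟩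
    refine Set.ncard_eq_one.2 ⟨e, Set.eq_singleton_iff_unique_mem.2
      ⟨congrArg Subtype.val he, fun f hf => hbij.1 (Subtype.ext ?_)⟩⟩
    exact Eq.trans hf (congrArg Subtype.val he).symm

theorem IsTight.isMapsAndTrees {G : Graph α β} {k ℓ : ℕ} (hℓ : ℓ ≤ k) (hV : V(G).Finite)
    (hE : E(G).Finite) (h : G.IsTight k ℓ) : G.IsMapsAndTrees k ℓ := by
  classical
  obtain ⟨d, rfl⟩ := Nat.exists_eq_add_of_le hℓ
  obtain ⟨hsparse, htight⟩ := h
  obtain ⟨P, hPE, hEP, hdisj, hP⟩ := exists_partition_of_submodular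
    (Sum.elim (fun (_ : Fin ℓ) (A : Finset β) => G.edgeRank A)
      (fun (_ : Fin (ℓ + d - ℓ)) A => (G.coveredVerts A).card))
    (by
      rintro (j | i) A B hAB
      · exact G.edgeRank_mono B.finite_toSet (Finset.coe_subset.2 hAB)
      · exact Finset.card_le_card (G.coveredVerts_mono hAB))
    (by
      rintro (j | i)
      · simpa using G.edgeRank_empty
      · simp [coveredVerts])
    (by
      rintro (j | i) A B
      · simpa using G.edgeRank_union_add_inter_le A.finite_toSet B.finite_toSet
      · exact G.card_coveredVerts_union_add_inter_le A B)
    hE.toFinset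
    (by
      intro A hA
      simpa using hsparse.card_le_rank_add A (by simpa using hA))
  have hPG : ∀ a, (P a : Set β) ⊆ E(G) := fun a e he => hE.mem_toFinset.1 (hPE a he)
  have hcov : ∀ A : Finset β, (G.coveredVerts A).card ≤ V(G).ncard := fun A => by
    rw [Set.ncard_eq_toFinset_card _ hV]
    refine Finset.card_le_card fun v hv => ?_
    obtain ⟨e, -, he⟩ := mem_coveredVerts.1 hv
    exact hV.mem_toFinset.2 he.vertex_mem
  have htight' : E(G).ncard + ℓ = (ℓ + d) * V(G).ncard := by
    have : ((E(G).ncard + ℓ : ℕ) : ℤ) = ((ℓ + d) * V(G).ncard : ℕ) := by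
      push_cast at htight ⊢; linarith
    exact_mod_cast this
  have hle : ∀ a, Sum.elim (fun j => (P (Sum.inl j)).card + 1) (fun i => (P (Sum.inr i)).card) a ≤
      V(G).ncard := by
    rintro (j | i)
    -- On an empty vertex set tightness forces `ℓ = 0`, but `j` is an index below `ℓ`.
    · have hne : V(G).Nonempty := by
        rw [← Set.ncard_pos hV, Nat.pos_iff_ne_zero]
        intro h0
        have := j.pos
        rw [h0, mul_zero] at htight'
        omega
      refine (Nat.add_le_add_right (hP (Sum.inl j) _ subset_rfl) 1).trans ?_
      rw [Set.ncard_eq_toFinset_card _ hV]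
      exact G.edgeRank_add_one_le_card (fun e _ x y h => hV.mem_toFinset.2 h.left_mem)
        (by simpa using hne)
    · exact (hP (Sum.inr i) _ subset_rfl).trans (hcov _)
  have hsum : ∑ a, (P a).card = E(G).ncard := by
    rw [Set.ncard_eq_toFinset_card _ hE, ← Finset.card_biUnion fun a _ b _ hab => hdisj hab]
    congr 1
    ext e
    simp only [Finset.mem_biUnion, Finset.mem_univ, true_and]
    exact ⟨fun ⟨a, ha⟩ => hPE a ha, hEP e⟩
  -- The individual upper bounds add up to `(ℓ + d) n`, which tightness attains, so each bound is an
  -- equality.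
  have heq := (Finset.sum_eq_sum_iff_of_le (s := Finset.univ) fun a _ => hle a).1 (by
    rw [Fintype.sum_sum_type] at hsum ⊢
    simp only [Sum.elim_inl, Sum.elim_inr, Finset.sum_add_distrib, Finset.sum_const,
      Finset.card_univ, Fintype.card_fin, Fintype.card_sum, smul_eq_mul, mul_one,
      Nat.add_sub_cancel_left]
    omega)
  refine ⟨fun j => G.restrict (P (Sum.inl j)), fun i => G.restrict (P (Sum.inr i)),
    fun j => ⟨⟨restrict_le, rfl⟩, ?_⟩,
    fun i => ⟨⟨restrict_le, rfl⟩, ?_⟩, ?_, ?_⟩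
  · refine isTree_restrict_of_ncard_le_edgeRank hV (Finset.finite_toSet _) ?_ ?_
    · rw [Set.ncard_coe_finset]
      exact hP (Sum.inl j) _ subset_rfl
    · rw [Set.ncard_coe_finset]
      exact heq (Sum.inl j) (Finset.mem_univ _)
  · exact isMapGraph_restrict_of_card_le hV (hPG _) (fun B hB => hP (Sum.inr i) B hB)
      (heq (Sum.inr i) (Finset.mem_univ _))
  all_goals
    have helim : ∀ a, E(Sum.elim (fun j => G.restrict (P (Sum.inl j)))
        (fun i => G.restrict (P (Sum.inr i))) a) = P a := by
      rintro (j | i)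
      · exact Set.inter_eq_right.2 (hPG _)
      · exact Set.inter_eq_right.2 (hPG _)
    simp only [helim]
  · intro a b hab
    exact Finset.disjoint_coe.2 (hdisj hab)
  · ext e
    simp only [Set.mem_iUnion, Finset.mem_coe]
    exact ⟨fun he => hEP e (hE.mem_toFinset.2 he), fun ⟨a, ha⟩ => hPG a ha⟩

end Graph

/-! ### The pebble game builds every sparse graph. -/

namespace PebbleConfig

variable {α β : Type*} {k : ℕ}

/-- The number of pebbles on a vertex. -/
def load (H : PebbleConfig α β k) (v : α) : ℕ := ∑ c, H.peb v c

open Classical in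
/-- The number of edges in `E` that are directed out of `v`. -/
noncomputable def outDeg (H : PebbleConfig α β k) (E : Finset β) (v : α) : ℕ :=
  {e ∈ E | (H.arc e).map Prod.fst = some v}.card

/-- There is an edge directed from `v` to `w`. -/
def HasArc (H : PebbleConfig α β k) (v w : α) : Prop := ∃ e c, H.arc e = some (v, w, c)

theorem exists_peb_of_load {H : PebbleConfig α β k} {v : α} (h : 1 ≤ H.load v) :
    ∃ c, 1 ≤ H.peb v c := by
  by_contra! hcon
  have : H.load v = 0 := Finset.sum_eq_zero fun c _ => by have := hcon c; omega
  omega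

open Classical in
theorem load_pickUp {H : PebbleConfig α β k} {v : α} {c : Fin k} (h : 1 ≤ H.peb v c) (z : α) :
    (H.pickUp v c).load z + (if z = v then 1 else 0) = H.load z := by
  by_cases hz : z = v
  · subst hz
    have h1 := Finset.add_sum_erase Finset.univ (H.peb z) (Finset.mem_univ c)
    have h2 := Finset.add_sum_erase Finset.univ ((H.pickUp z c).peb z) (Finset.mem_univ c)
    have h3 : ∑ d ∈ Finset.univ.erase c, (H.pickUp z c).peb z d =
        ∑ d ∈ Finset.univ.erase c, H.peb z d := Finset.sum_congr rfl fun d hd => by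
      simp [pickUp, Function.update_of_ne (Finset.ne_of_mem_erase hd)]
    have h4 : (H.pickUp z c).peb z c = H.peb z c - 1 := by simp [pickUp]
    simp only [load, if_true]
    omega
  · simp [load, pickUp, hz]

open Classical in
theorem load_putDown (H : PebbleConfig α β k) (v : α) (c : Fin k) (z : α) :
    (H.putDown v c).load z = H.load z + if z = v then 1 else 0 := by
  by_cases hz : z = v
  · subst hz
    have h1 := Finset.add_sum_erase Finset.univ (H.peb z) (Finset.mem_univ c)
    have h2 := Finset.add_sum_erase Finset.univ ((H.putDown z c).peb z) (Finset.mem_univ c)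
    have h3 : ∑ d ∈ Finset.univ.erase c, (H.putDown z c).peb z d =
        ∑ d ∈ Finset.univ.erase c, H.peb z d := Finset.sum_congr rfl fun d hd => by
      simp [putDown, Function.update_of_ne (Finset.ne_of_mem_erase hd)]
    have h4 : (H.putDown z c).peb z c = H.peb z c + 1 := by simp [putDown]
    simp only [load, if_true]
    omega
  · simp [load, putDown, hz]

open Classical in
theorem outDeg_setArc (H : PebbleConfig α β k) {E : Finset β} {e : β} (he : e ∈ E) (v w : α)
    (c : Fin k) (z : α) :
    (H.setArc e v w c).outDeg E z + (if (H.arc e).map Prod.fst = some z then 1 else 0) =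
      H.outDeg E z + if z = v then 1 else 0 := by
  simp only [outDeg, Finset.card_filter]
  rw [← Finset.add_sum_erase E _ he, ← Finset.add_sum_erase E
    (fun f => if (H.arc f).map Prod.fst = some z then 1 else 0) he]
  have h1 : ∑ f ∈ E.erase e, (if ((H.setArc e v w c).arc f).map Prod.fst = some z then 1 else 0) =
      ∑ f ∈ E.erase e, (if (H.arc f).map Prod.fst = some z then 1 else 0) :=
    Finset.sum_congr rfl fun f hf => by
      simp only [setArc, Function.update_of_ne (Finset.ne_of_mem_erase hf)]
  have h2 : (H.setArc e v w c).arc e = some (v, w, c) := by simp [setArc]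
  rw [h1, h2]
  simp only [Option.map_some, Option.some.injEq, eq_comm (a := v)]
  omega

/-- `H` is the output of a play on the vertex set of `G`, its underlying graph has the edges
`D` of `G`, and every vertex has in total `k` pebbles on itself and on its outgoing edges. -/
structure Realizes (H : PebbleConfig α β k) (G : Graph α β) (ℓ : ℕ) (E D : Finset β) : Prop where
  isOutput : H.IsOutput V(G) ℓ
  arc_iff : ∀ e x y, (∃ c, H.arc e = some (x, y, c) ∨ H.arc e = some (y, x, c)) ↔
    e ∈ D ∧ G.IsLink e x y
  budget : ∀ v ∈ V(G), H.load v + H.outDeg E v = k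

namespace Realizes

variable {H : PebbleConfig α β k} {G : Graph α β} {ℓ : ℕ} {E D : Finset β}

theorem of_arc (hH : H.Realizes G ℓ E D) {e : β} {v w : α} {c : Fin k}
    (he : H.arc e = some (v, w, c)) : e ∈ D ∧ G.IsLink e v w :=
  (hH.arc_iff e v w).1 ⟨c, Or.inl he⟩

theorem arc_eq_none (hH : H.Realizes G ℓ E D) {e : β} (he : e ∉ D) : H.arc e = none := by
  match h : H.arc e with
  | none => rfl
  | some (v, w, c) => exact absurd (hH.of_arc h).1 he

-- A slide carries one pebble from the head of `e` to its tail. The additive form of the load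
-- balance also covers loops, and the unchanged arcs allow slides to be chained along a path.
open Classical in
theorem exists_slide (hH : H.Realizes G ℓ E D) (hDE : D ⊆ E) {e : β} {v w : α} {d : Fin k}
    (he : H.arc e = some (v, w, d)) (hw : 1 ≤ H.load w) :
    ∃ H' : PebbleConfig α β k, H'.Realizes G ℓ E D ∧
      (∀ z, H'.load z + (if z = w then 1 else 0) = H.load z + if z = v then 1 else 0) ∧
      ∀ f ≠ e, H'.arc f = H.arc f := by
  obtain ⟨c, hc⟩ := exists_peb_of_load hw
  have hload : ∀ z, ((((H.pickUp w c).putDown v d).setArc e w v c).load z +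
      if z = w then 1 else 0) = H.load z + if z = v then 1 else 0 := by
    intro z
    have h1 := load_pickUp hc z
    have h2 := load_putDown (H.pickUp w c) v d z
    have h3 : (((H.pickUp w c).putDown v d).setArc e w v c).load z =
      ((H.pickUp w c).putDown v d).load z := rfl
    omega
  have harc : ∀ f ≠ e, (((H.pickUp w c).putDown v d).setArc e w v c).arc f = H.arc f :=
    fun f hf => Function.update_of_ne hf _ _
  have harc' : (((H.pickUp w c).putDown v d).setArc e w v c).arc e = some (w, v, c) := by
    simp [setArc]
  refine ⟨_, ⟨hH.isOutput.tail (.pebbleSlide H e v w c d hc he), fun f x y => ?_, fun z hz => ?_⟩,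
    hload, harc⟩
  · rw [← hH.arc_iff]
    by_cases hf : f = e
    · subst hf
      rw [harc', he]
      constructor
      · rintro ⟨_, h | h⟩ <;> cases h
        · exact ⟨d, Or.inr rfl⟩
        · exact ⟨d, Or.inl rfl⟩
      · rintro ⟨_, h | h⟩ <;> cases h
        · exact ⟨c, Or.inr rfl⟩
        · exact ⟨c, Or.inl rfl⟩
    · rw [harc f hf]
  · have h1 := outDeg_setArc ((H.pickUp w c).putDown v d) (hDE (hH.of_arc he).1) w v c z
    have h2 : (((H.pickUp w c).putDown v d).arc e).map Prod.fst = some v := by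
      change (H.arc e).map Prod.fst = some v
      rw [he]; rfl
    have h3 : ((H.pickUp w c).putDown v d).outDeg E z = H.outDeg E z := rfl
    rw [h2, h3] at h1
    simp only [Option.some.injEq, eq_comm (a := v)] at h1
    have := hload z
    have := hH.budget z hz
    omega

open Classical in
/-- A pebble can be moved backwards along a directed path. -/
theorem exists_slide_path (hDE : D ⊆ E) (n : ℕ) (w : ℕ → α) (hinj : Set.InjOn w (Set.Iic n)) :
    ∀ H : PebbleConfig α β k, H.Realizes G ℓ E D → (∀ i < n, H.HasArc (w i) (w (i + 1))) →
    1 ≤ H.load (w n) → ∃ H' : PebbleConfig α β k, H'.Realizes G ℓ E D ∧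
      ∀ z, H'.load z + (if z = w n then 1 else 0) = H.load z + if z = w 0 then 1 else 0 := by
  induction n with
  | zero => exact fun H hH _ _ => ⟨H, hH, fun z => rfl⟩
  | succ n ih =>
    intro H hH harc hload
    -- The arc next to the pebble is slid first. Earlier arcs survive, since one equal to `e` would
    -- repeat the vertex `w n`.
    obtain ⟨e, d, he⟩ := harc n n.lt_succ_self
    obtain ⟨H₁, hH₁, hload₁, harc₁⟩ := hH.exists_slide hDE he hload
    have hne : w n ≠ w (n + 1) := fun h => by
      have := hinj (Set.mem_Iic.2 n.le_succ) (Set.mem_Iic.2 le_rfl) h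
      omega
    obtain ⟨H₂, hH₂, hload₂⟩ := ih (hinj.mono (Set.Iic_subset_Iic.2 n.le_succ)) H₁ hH₁
      (fun i hi => by
        obtain ⟨f, c, hf⟩ := harc i (by omega)
        refine ⟨f, c, (harc₁ f ?_).trans hf⟩
        rintro rfl
        rw [he, Option.some.injEq, Prod.mk.injEq] at hf
        have := hinj (Set.mem_Iic.2 n.le_succ) (Set.mem_Iic.2 (by omega)) hf.1
        omega)
      (by
        have := hload₁ (w n)
        rw [if_neg hne, if_pos rfl] at this
        omega)
    refine ⟨H₂, hH₂, fun z => ?_⟩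
    have := hload₁ z
    have := hload₂ z
    omega

open Classical in
/-- In a sparse graph, as long as there are at most `ℓ` pebbles on the ends of an edge that is
not yet in the configuration, another pebble can be brought there. -/
theorem exists_pebCount_succ (hH : H.Realizes G ℓ E D) (hDE : D ⊆ E) (hV : V(G).Finite)
    (hG : G.IsSparse k ℓ) {e : β} {x y : α} (hxy : G.IsLink e x y) (he : e ∉ D)
    (hle : H.pebCount {x, y} ≤ ℓ) : ∃ H' : PebbleConfig α β k, H'.Realizes G ℓ E D ∧
      H'.pebCount {x, y} = H.pebCount {x, y} + 1 := by
  set S : Finset α := {x, y} with hS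
  have hSV : ∀ s ∈ S, s ∈ V(G) := fun s hs => by
    rw [hS, Finset.mem_insert, Finset.mem_singleton] at hs
    rcases hs with rfl | rfl
    · exact hxy.left_mem
    · exact hxy.right_mem
  set R : Finset α := {z ∈ hV.toFinset | ∃ s ∈ S, Relation.ReflTransGen H.HasArc s z} with hR
  have hRV : ∀ z ∈ R, z ∈ V(G) := fun z hz => hV.mem_toFinset.1 (Finset.mem_filter.1 hz).1
  have hSR : S ⊆ R := fun s hs =>
    Finset.mem_filter.2 ⟨hV.mem_toFinset.2 (hSV s hs), s, hs, .refl⟩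
  -- A reachable pebble outside `S` is slid back to `S`, which gains exactly one pebble: the path
  -- starts in `S` and ends outside.
  by_cases hu : ∃ u ∈ R, u ∉ S ∧ 1 ≤ H.load u
  · obtain ⟨u, huR, huS, hu⟩ := hu
    obtain ⟨-, s, hs, hsu⟩ := Finset.mem_filter.1 huR
    obtain ⟨n, w, rfl, rfl, harc, hinj⟩ := hsu.exists_injOn_path
    obtain ⟨H', hH', hload⟩ := exists_slide_path hDE n w hinj H hH harc hu
    refine ⟨H', hH', ?_⟩
    have h1 := Finset.sum_congr rfl fun z (_ : z ∈ S) => hload z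
    rw [Finset.sum_add_distrib, Finset.sum_add_distrib, Finset.sum_ite_eq', Finset.sum_ite_eq',
      if_neg huS, if_pos hs] at h1
    exact h1
  · exfalso
    push Not at hu
    have hload : ∑ z ∈ S, H.load z = ∑ z ∈ R, H.load z :=
      Finset.sum_subset hSR fun z hz hzS => by have := hu z hz hzS; omega
    -- `R` is closed under outgoing arcs, so the edges of `B` have both ends in `R`. By the budget
    -- there are `k |R|` minus the pebbles on `R` of them; all these pebbles lie on `S`, so there
    -- are at most `ℓ`. Adding `e` exceeds the sparsity bound.
    set B : Finset β := R.biUnion fun z => {f ∈ E | (H.arc f).map Prod.fst = some z} with hB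
    have hBcard : B.card = ∑ z ∈ R, H.outDeg E z := by
      refine Finset.card_biUnion fun a _ b _ hab => Finset.disjoint_left.2 fun f ha hb => hab ?_
      have ha := (Finset.mem_filter.1 ha).2
      rw [(Finset.mem_filter.1 hb).2] at ha
      exact (Option.some.inj ha).symm
    have hBarc : ∀ f ∈ B, ∃ a ∈ R, ∃ b ∈ R, f ∈ D ∧ G.IsLink f a b := by
      intro f hf
      obtain ⟨a, haR, hf⟩ := Finset.mem_biUnion.1 hf
      obtain ⟨⟨a', b, c⟩, hfarc, rfl⟩ := Option.map_eq_some_iff.1 (Finset.mem_filter.1 hf).2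
      obtain ⟨hfD, hlink⟩ := hH.of_arc hfarc
      obtain ⟨-, s, hs, hsa⟩ := Finset.mem_filter.1 haR
      exact ⟨a', haR, b, Finset.mem_filter.2 ⟨hV.mem_toFinset.2 hlink.right_mem, s, hs,
        hsa.tail ⟨f, c, hfarc⟩⟩, hfD, hlink⟩
    have heB : e ∉ B := fun h => by
      obtain ⟨-, -, -, -, hD, -⟩ := hBarc e h
      exact he hD
    have hx : x ∈ R := hSR (by simp [hS])
    have hy : y ∈ R := hSR (by simp [hS])
    have hends : ∀ f ∈ insert e B, ∃ a ∈ R, ∃ b ∈ R, G.IsLink f a b := by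
      intro f hf
      rcases Finset.mem_insert.1 hf with rfl | hf
      · exact ⟨x, hx, y, hy, hxy⟩
      · obtain ⟨a, ha, b, hb, -, h⟩ := hBarc f hf
        exact ⟨a, ha, b, hb, h⟩
    have hsp := hG.card_add_le (A := insert e B) (W := R)
      (fun f hf => by obtain ⟨a, -, b, -, h⟩ := hends f hf; exact h.edge_mem)
      (Finset.insert_nonempty _ _) hRV
      (fun f hf p q hpq => by
        obtain ⟨a, ha, b, hb, h⟩ := hends f hf
        rcases hpq.left_eq_or_eq h with rfl | rfl
        · exact ha
        · exact hb)
    rw [Finset.card_insert_of_notMem heB, hBcard] at hsp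
    have hbudget := Finset.sum_congr rfl fun z (hz : z ∈ R) => hH.budget z (hRV z hz)
    rw [Finset.sum_add_distrib, ← hload, Finset.sum_const, smul_eq_mul, mul_comm] at hbudget
    have : H.pebCount S = ∑ z ∈ S, H.load z := rfl
    omega

open Classical in
theorem exists_le_pebCount (hH : H.Realizes G ℓ E D) (hDE : D ⊆ E) (hV : V(G).Finite)
    (hG : G.IsSparse k ℓ) {e : β} {x y : α} (hxy : G.IsLink e x y) (he : e ∉ D) (m : ℕ)
    (hm : m ≤ ℓ + 1) : ∃ H' : PebbleConfig α β k, H'.Realizes G ℓ E D ∧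
      m ≤ H'.pebCount {x, y} := by
  induction m with
  | zero => exact ⟨H, hH, Nat.zero_le _⟩
  | succ m ih =>
    obtain ⟨H₁, hH₁, h₁⟩ := ih (by omega)
    by_cases hlt : m + 1 ≤ H₁.pebCount {x, y}
    · exact ⟨H₁, hH₁, hlt⟩
    · obtain ⟨H₂, hH₂, h₂⟩ := hH₁.exists_pebCount_succ hDE hV hG hxy he (by omega)
      exact ⟨H₂, hH₂, by omega⟩

open Classical in
theorem exists_addEdge (hH : H.Realizes G ℓ E D) {e : β} {x y : α} (hxy : G.IsLink e x y)
    (he : e ∉ D) (heE : e ∈ E) (hle : ℓ + 1 ≤ H.pebCount {x, y}) (hx : 1 ≤ H.load x) :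
    ∃ H' : PebbleConfig α β k, H'.Realizes G ℓ E (insert e D) := by
  obtain ⟨c, hc⟩ := exists_peb_of_load hx
  have hnone := hH.arc_eq_none he
  refine ⟨(H.pickUp x c).setArc e x y c, hH.isOutput.tail
    (.addEdge H e x y c hxy.left_mem hxy.right_mem hnone hle hc), fun f a b => ?_, fun z hz => ?_⟩
  · by_cases hf : f = e
    · subst hf
      have harc : ((H.pickUp x c).setArc f x y c).arc f = some (x, y, c) := by
        simp [setArc]
      rw [harc, hxy.isLink_iff]
      constructor
      · rintro ⟨_, h | h⟩ <;> cases h <;> simp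
      · rintro ⟨-, ⟨rfl, rfl⟩ | ⟨rfl, rfl⟩⟩
        · exact ⟨c, Or.inl rfl⟩
        · exact ⟨c, Or.inr rfl⟩
    · have harc : ((H.pickUp x c).setArc e x y c).arc f = H.arc f := Function.update_of_ne hf _ _
      rw [harc, hH.arc_iff, Finset.mem_insert, or_iff_right hf]
  · have h1 := outDeg_setArc (H.pickUp x c) heE x y c z
    have h2 : ((H.pickUp x c).arc e).map Prod.fst = none := by
      change (H.arc e).map Prod.fst = none
      rw [hnone]; rfl
    have h3 : (H.pickUp x c).outDeg E z = H.outDeg E z := rfl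
    have h4 : ((H.pickUp x c).setArc e x y c).load z = (H.pickUp x c).load z := rfl
    rw [h2, h3, if_neg (by simp)] at h1
    have := load_pickUp hc z
    have := hH.budget z hz
    omega

end Realizes

theorem realizes_initial (G : Graph α β) (ℓ : ℕ) (E : Finset β) :
    (initial V(G) : PebbleConfig α β k).Realizes G ℓ E ∅ := by
  refine ⟨.refl, by simp [initial], fun v hv => ?_⟩
  simp [load, outDeg, initial, hv]

/-- Induction on `D`, with `E` fixed so that out-degrees are always counted over the same finite
set. -/
theorem exists_realizes {G : Graph α β} {ℓ : ℕ} (hV : V(G).Finite) (hG : G.IsSparse k ℓ)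
    (E D : Finset β) (hDE : D ⊆ E) (hDG : ∀ e ∈ D, e ∈ E(G)) :
    ∃ H : PebbleConfig α β k, H.Realizes G ℓ E D := by
  classical
  induction D using Finset.induction_on with
  | empty => exact ⟨_, realizes_initial G ℓ E⟩
  | insert e D he ih =>
    have hDE' := (Finset.subset_insert e D).trans hDE
    obtain ⟨H, hH⟩ := ih hDE' fun f hf => hDG f (Finset.mem_insert_of_mem hf)
    obtain ⟨x, y, hxy⟩ := G.exists_isLink_of_mem_edgeSet (hDG e (Finset.mem_insert_self e D))
    have heE := hDE (Finset.mem_insert_self e D)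
    obtain ⟨H, hH, hle⟩ := hH.exists_le_pebCount hDE' hV hG hxy he (ℓ + 1) le_rfl
    -- At least `ℓ + 1 ≥ 1` pebbles lie on the two ends; the new edge is directed away from an end
    -- that has one.
    by_cases hx : 1 ≤ H.load x
    · convert hH.exists_addEdge hxy he heE hle hx
    · have hle' : ℓ + 1 ≤ H.pebCount {y, x} := by rwa [Finset.pair_comm]
      have hy : 1 ≤ H.load y := by
        by_contra hy
        have : H.pebCount {x, y} = 0 := Finset.sum_eq_zero fun z hz => by
          rw [Finset.mem_insert, Finset.mem_singleton] at hz
          rcases hz with rfl | rfl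
          · exact Nat.lt_one_iff.1 (not_le.1 hx)
          · exact Nat.lt_one_iff.1 (not_le.1 hy)
        omega
      convert hH.exists_addEdge hxy.symm he heE hle' hy

end PebbleConfig

/-! ### Assembly of the theorem. -/

theorem Graph.IsSparse.isPebbleGameGraph {α β : Type*} {G : Graph α β} {k ℓ : ℕ}
    (hG : G.IsSparse k ℓ) (hV : V(G).Finite) (hE : E(G).Finite) : G.IsPebbleGameGraph k ℓ := by
  obtain ⟨H, hH⟩ := PebbleConfig.exists_realizes hV hG hE.toFinset hE.toFinset subset_rfl
    fun e => hE.mem_toFinset.1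
  refine ⟨H, hH.isOutput, fun e x y => ?_⟩
  rw [hH.arc_iff, hE.mem_toFinset]
  exact ⟨fun h => ⟨h.edge_mem, h⟩, And.right⟩

theorem mainTheorem3 {α β : Type*} (k ℓ : ℕ) (hℓ : ℓ ≤ k)
    (G : Graph α β) (hV : V(G).Finite) (hE : E(G).Finite) :
    (G.IsTight k ℓ ∧ G.IsPebbleGameGraph k ℓ) ↔ G.IsMapsAndTrees k ℓ := by
  constructor
  · rintro ⟨h, -⟩
    exact h.isMapsAndTrees hℓ hV hE
  · intro h
    have ht := h.isTight hℓ hV hE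
    exact ⟨ht, ht.1.isPebbleGameGraph hV hE⟩
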